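/- Let $n\ge 2$ and identify $\mathbb C^n$ with $\mathbb R^{2n}$ through $(\xi_{11}+i\xi_{12},\dots,\xi_{n1}+i\xi_{n2})\mapsto(\xi_{11},\xi_{12},\dots,\xi_{n1},\xi_{n2})$. Let $K\subset\mathbb R^{2n}$ be an origin-symmetric convex body (compact, convex, with non-empty interior) with Minkowski functional $\|x\|_K=\min\{a\ge 0: x\in aK\}$. Assume that $K$ is infinitely smooth, i.e. the restriction of $\|\cdot\|_K$ to the unit sphere $S^{2n-1}$ is a $C^\infty$ function, and that $K$ is invariant with respect to all $R_\theta$, i.e. for every $\theta\in[0,2\pi]$ the functional $\|\cdot\|_K$ is invariant under the map of $\mathbb R^{2n}$ that rotates each pair of coordinates $(\xi_{k1},\xi_{k2})$ counterclockwise by the angle $\theta$. For $\xi\in S^{2n-1}$ let $H_\xi=\{z\in\mathbb C^n:\sum_{k=1}^n z_k\overline{\xi_k}=0\}$, viewed as a $(2n-2)$-dimensional subspace of $\mathbb R^{2n}$. Define the Fourier transform of a tempered distribution $f$ on $\mathbb R^{2n}$ by $\langle\hat f,\varphi\rangle=\langle f,\hat\varphi\rangle$ for Schwartz functions $\varphi$,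 where $\hat\varphi(x)=\int_{\mathbb R^{2n}}\varphi(y)e^{-i(x,y)}\,dy$. Then $\|x\|_K^{-2n+2}$ defines (by integration) a tempered distribution, its Fourier transform is given by a function that is continuous on $\mathbb R^{2n}\setminus\{0\}$ (hence uniquely determined there), and the values of this function satisfy, for every $\xi\in S^{2n-1}$, $$\mathrm{vol}_{2n-2}(K\cap H_\xi)=\frac{1}{4\pi(n-1)}\left(\|x\|_K^{-2n+2}\right)^\wedge(\xi).$$ -/

import Mathlib

open MeasureTheory
open scoped SchwartzMap ContDiff Manifold

noncomputable section

namespace ComplexSections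

/-- The space `ℝ²ⁿ` with its Euclidean structure and coordinates `(x₁₁, x₁₂, …, xₙ₁, xₙ₂)`;
the coordinates `x (k, 0)` and `x (k, 1)` are the real and the imaginary part of the `k`-th
complex coordinate. -/
abbrev Space (n : ℕ) : Type := EuclideanSpace ℝ (Fin n × Fin 2)

/-- The `k`-th complex coordinate of a point of `ℝ²ⁿ`. -/
def cplx {n : ℕ} (x : Space n) (k : Fin n) : ℂ := ⟨x (k, 0), x (k, 1)⟩

/-- The coordinatewise counterclockwise rotation `R_θ` of `ℝ²ⁿ`. -/
def rotate {n : ℕ} (θ : ℝ) (x : Space n) : Space n :=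
  WithLp.toLp 2 fun p =>
    ![Real.cos θ * x (p.1, 0) - Real.sin θ * x (p.1, 1),
      Real.sin θ * x (p.1, 0) + Real.cos θ * x (p.1, 1)] p.2

/-- Invariance of a set with respect to all `R_θ`, expressed through the Minkowski functional. -/
def IsRotationInvariant {n : ℕ} (K : Set (Space n)) : Prop :=
  ∀ θ ∈ Set.Icc (0 : ℝ) (2 * Real.pi), ∀ x : Space n, gauge K (rotate θ x) = gauge K x

/-- The complex hyperplane `H_ξ = {z : ∑ₖ zₖ * conj ξₖ = 0}`, as a real subspace of `ℝ²ⁿ`. -/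
def complexHyperplane {n : ℕ} (ξ : Space n) : Submodule ℝ (Space n) where
  carrier := {z | ∑ k, cplx z k * (starRingEnd ℂ) (cplx ξ k) = 0}
  zero_mem' := by
    have h : ∀ k, cplx (0 : Space n) k = 0 := fun k => by
      apply Complex.ext <;> simp [cplx]
    simp [h]
  add_mem' := by
    intro a b ha hb
    have h : ∀ k, cplx (a + b) k = cplx a k + cplx b k := fun k => by
      apply Complex.ext <;> simp [cplx]
    simp only [Set.mem_ofPred_eq] at ha hb ⊢
    simp only [h, add_mul, Finset.sum_add_distrib, ha, hb, add_zero]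
  smul_mem' := by
    intro c a ha
    have h : ∀ k, cplx (c • a) k = (c : ℂ) * cplx a k := fun k => by
      apply Complex.ext <;> simp [cplx]
    simp only [Set.mem_ofPred_eq] at ha ⊢
    simp only [h, mul_assoc, ← Finset.mul_sum, ha, mul_zero]

/-- The volume of the section `K ∩ H`, i.e. its Lebesgue measure in the Euclidean space `H`
(not the restriction of the Lebesgue measure of the ambient space). -/
def sectionVolume {n : ℕ} (K : Set (Space n)) (H : Submodule ℝ (Space n)) : ℝ :=
  (@volume H measureSpaceOfInnerProductSpace).real ((↑) ⁻¹' K)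

section Euclidean

variable {E : Type*} [NormedAddCommGroup E] [InnerProductSpace ℝ E]

/-- A set is infinitely smooth if the restriction of its Minkowski functional to the unit sphere
is a `C^∞` function on the sphere. -/
def IsInfinitelySmooth (K : Set E) : Prop :=
  ∀ (m : ℕ) (h : Module.finrank ℝ E = m + 1),
    haveI : Fact (Module.finrank ℝ E = m + 1) := ⟨h⟩
    ContMDiff (𝓡 m) 𝓘(ℝ, ℝ) ∞ (fun x : Metric.sphere (0 : E) 1 => gauge K (x : E))

variable [FiniteDimensional ℝ E] [MeasurableSpace E] [BorelSpace E]

/-- Multiplication by `(2π)⁻¹` on `E`. -/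
def dilation (E : Type*) [NormedAddCommGroup E] [InnerProductSpace ℝ E] : E ≃L[ℝ] E :=
  ContinuousLinearEquiv.smulLeft
    (Units.mk0 ((2 * Real.pi)⁻¹ : ℝ) (inv_ne_zero Real.two_pi_pos.ne'))

/-- The Fourier transform on test functions, `φ̂(x) = ∫ φ(y) exp(-i⟨x, y⟩) dy`
(see `testFourier_apply`). -/
def testFourier : 𝓢(E, ℂ) →L[ℂ] 𝓢(E, ℂ) :=
  (SchwartzMap.compCLMOfContinuousLinearEquiv ℂ (dilation E)) ∘L
    (SchwartzMap.fourierTransformCLM ℂ)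

theorem testFourier_apply (φ : 𝓢(E, ℂ)) (x : E) :
    testFourier φ x = ∫ y, Complex.exp (-(Complex.I * (inner ℝ x y : ℝ))) * φ y := by
  have h : testFourier φ x = FourierTransform.fourier (φ : E → ℂ) (dilation E x) := rfl
  rw [h, Real.fourier_eq']
  refine integral_congr_ae (Filter.Eventually.of_forall fun y => ?_)
  have hd : dilation E x = (2 * Real.pi)⁻¹ • x := rfl
  have h2 : -2 * Real.pi * inner ℝ y (dilation E x) = -inner ℝ x y := by
    rw [hd, inner_smul_right, real_inner_comm]
    field_simp
  simp only [h2, smul_eq_mul]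
  congr 2
  push_cast
  ring

/-- The Fourier transform of tempered distributions, `⟨T̂, φ⟩ = ⟨T, φ̂⟩`. -/
def distFourier (T : 𝓢'(E, ℂ)) : 𝓢'(E, ℂ) :=
  PointwiseConvergenceCLM.precomp ℂ testFourier T

theorem distFourier_apply (T : 𝓢'(E, ℂ)) (φ : 𝓢(E, ℂ)) :
    distFourier T φ = T (testFourier φ) := rfl

/-- The tempered distribution `T` is (given by integration against) the function `f`. -/
def IsGivenBy (T : 𝓢'(E, ℂ)) (f : E → ℂ) : Prop :=
  ∀ φ : 𝓢(E, ℂ), Integrable (fun x => f x * φ x) ∧ T φ = ∫ x, f x * φ x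

end Euclidean

end ComplexSections

end

open ComplexSections

/-!
The Fourier transform of `‖x‖_K^(2-2n)` is identified directly, by computing both sides of
`∫ ‖x‖_K^(2-2n) φ̂(x) dx = ∫ g(y) φ(y) dy`, with
`g(y) = 4π(n-1) ‖y‖⁻² vol(K ∩ H_y)`, for every Schwartz function `φ`. Two evaluations of the
integral of `φ̂(w x)` over `x ∈ K`, `w ∈ ℂ` are compared, where `w x` is the product of the vector
`x ∈ ℂⁿ` with the complex scalar `w`.

* Invariance of `K` under the rotations `R_θ` says that `‖w x‖_K = |w| ‖x‖_K` for complex `w`.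
  Substituting `x ↦ w⁻¹ x` for fixed `w` and integrating over `w` first, the integral becomes
  `∫ φ̂(x) ∫_{|w| ≥ ‖x‖_K} |w|^(-2n) dw dx`, that is `2π / (2n-2) * ∫ ‖x‖_K^(2-2n) φ̂(x) dx`
  (`integral_complex_lines`).
* Insert a factor `exp(-s²|w|²/2)`. As `⟨w x, y⟩ = Re (w ⟨x, y⟩_ℂ)`, the integral over `w` is the
  Fourier transform of a Gaussian at `⟨x, y⟩_ℂ`, and the integral becomes
  `∫ φ(y) ∫_K (2π/s²) exp(-|⟨x, y⟩_ℂ|²/(2s²)) dx dy` (`integral_testFourier_gaussian`,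
  `integral_body_gaussian`). As `s → 0` the inner integral tends to `4π² ‖y‖⁻² vol(K ∩ H_y)`, and
  it is at most a constant times `‖y‖⁻²` (`tendsto_gaussianSection`, `exists_gaussianSection_le`);
  this singularity is integrable because `2 < 2n`.

The function `g` is continuous off the origin since the volume of a central section of a convex
body depends continuously on the section: linear isometries form a compact set
(`exists_subseq_tendsto_isometry`), and the relative boundary of a section is negligible
(`tendsto_volume_section`). A function which is continuous off the origin is determined there by
the distribution it gives (`IsGivenBy.eqOn_compl_zero`), so every representative of the Fourier
transform takes the values of `g` on the sphere.
-/

noncomputable section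
open Filter Topology
open Module (finrank)

namespace ComplexSections

variable {n : ℕ}

/-! ### The complex structure of `ℝ²ⁿ` -/

/-- Coordinatewise multiplication by the imaginary unit, as a real linear isometry. -/
def mulI : Space n →ₗᵢ[ℝ] Space n where
  toFun x := WithLp.toLp 2 fun p => ![-x (p.1, 1), x (p.1, 0)] p.2
  map_add' x y := by
    ext ⟨k, i⟩
    fin_cases i <;> simp
    ring
  map_smul' c x := by
    ext ⟨k, i⟩
    fin_cases i <;> simp
  norm_map' x := by
    simp [EuclideanSpace.norm_eq, Fintype.sum_prod_type, add_comm]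

theorem mulI_apply_zero (x : Space n) (k : Fin n) : mulI x (k, 0) = -x (k, 1) := rfl

theorem mulI_apply_one (x : Space n) (k : Fin n) : mulI x (k, 1) = x (k, 0) := rfl

theorem mulI_mulI (x : Space n) : mulI (mulI x) = -x := by
  ext ⟨k, i⟩
  fin_cases i <;> simp [mulI_apply_zero, mulI_apply_one]

theorem inner_mulI_left (x y : Space n) : inner ℝ (mulI x) y = -inner ℝ x (mulI y) := by
  rw [← mulI.inner_map_map (mulI x) y, mulI_mulI, inner_neg_left]

theorem inner_mulI_self (x : Space n) : inner ℝ x (mulI x) = 0 := by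
  have h := inner_mulI_left x x
  rw [real_inner_comm] at h
  linarith

/-- Multiplication of a point of `ℝ²ⁿ = ℂⁿ` by a complex scalar, as a real linear map. -/
def cmul (w : ℂ) : Space n →L[ℝ] Space n :=
  w.re • ContinuousLinearMap.id ℝ (Space n) + w.im • mulI.toContinuousLinearMap

theorem cmul_apply (w : ℂ) (x : Space n) : cmul w x = w.re • x + w.im • mulI x := rfl

theorem continuous_cmul : Continuous fun p : ℂ × Space n => cmul p.1 p.2 := by
  simp only [cmul_apply]
  have := (mulI (n := n)).continuous
  fun_prop

theorem cmul_mul (v w : ℂ) (x : Space n) : cmul (v * w) x = cmul v (cmul w x) := by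
  simp only [cmul_apply, map_add, map_smul, mulI_mulI, Complex.mul_re, Complex.mul_im]
  module

theorem cmul_ofReal (r : ℝ) (x : Space n) : cmul (r : ℂ) x = r • x := by
  simp [cmul_apply]

theorem norm_cmul (w : ℂ) (x : Space n) : ‖cmul w x‖ = ‖w‖ * ‖x‖ := by
  rw [← sq_eq_sq₀ (norm_nonneg _) (by positivity), mul_pow, cmul_apply, norm_add_sq_real,
    norm_smul, norm_smul, inner_smul_left, inner_smul_right, inner_mulI_self, mulI.norm_map,
    Complex.sq_norm, Complex.normSq_apply, mul_pow, mul_pow]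
  simp only [Real.norm_eq_abs, sq_abs]
  ring

theorem rotate_eq_cmul (θ : ℝ) (x : Space n) :
    rotate θ x = cmul (Complex.exp (θ * Complex.I)) x := by
  ext ⟨k, i⟩
  fin_cases i <;>
    simp [rotate, cmul_apply, mulI_apply_zero, mulI_apply_one, Complex.exp_ofReal_mul_I_re,
      Complex.exp_ofReal_mul_I_im] <;> ring

/-- Invariance of a set under the rotations makes its Minkowski functional absolutely homogeneous
with respect to complex scalars. -/
theorem IsRotationInvariant.gauge_cmul {K : Set (Space n)} (h : IsRotationInvariant K)
    (w : ℂ) (x : Space n) : gauge K (cmul w x) = ‖w‖ * gauge K x := by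
  obtain ⟨θ, hθ, hw⟩ : ∃ θ ∈ Set.Icc (0 : ℝ) (2 * Real.pi),
      Complex.exp (θ * Complex.I) = Complex.exp (w.arg * Complex.I) := by
    refine ⟨toIcoMod Real.two_pi_pos 0 w.arg, ?_, ?_⟩
    · have := toIcoMod_mem_Ico Real.two_pi_pos 0 w.arg
      exact ⟨this.1, by simpa using this.2.le⟩
    · rw [Complex.exp_eq_exp_iff_exists_int]
      refine ⟨-toIcoDiv Real.two_pi_pos 0 w.arg, ?_⟩
      simp only [toIcoMod]
      push_cast
      simp
      ring
  rw [← Complex.norm_mul_exp_arg_mul_I w, cmul_mul, cmul_ofReal,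
    gauge_smul_of_nonneg (norm_nonneg w), ← hw, ← rotate_eq_cmul, h θ hθ]
  simp [Complex.norm_exp_ofReal_mul_I]

/-- The Hermitian product `∑ₖ xₖ * conj yₖ` of `ℝ²ⁿ = ℂⁿ`, expressed through the real one. -/
def herm (x y : Space n) : ℂ := ⟨inner ℝ x y, inner ℝ x (mulI y)⟩

theorem continuous_herm : Continuous fun p : Space n × Space n => herm p.1 p.2 := by
  have h : ∀ p : Space n × Space n, herm p.1 p.2 =
      Complex.equivRealProdCLM.symm (inner ℝ p.1 p.2, inner ℝ p.1 (mulI p.2)) := fun p => rfl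
  simp only [h]
  have := (mulI (n := n)).continuous
  fun_prop

theorem mem_complexHyperplane_iff (z ξ : Space n) : z ∈ complexHyperplane ξ ↔ herm z ξ = 0 := by
  have h : ∑ k, cplx z k * (starRingEnd ℂ) (cplx ξ k) = herm z ξ := by
    apply Complex.ext
    · simp [herm, cplx, PiLp.inner_apply, Fintype.sum_prod_type, mul_comm]
    · simp [herm, cplx, PiLp.inner_apply, Fintype.sum_prod_type, mulI_apply_zero, mulI_apply_one]
      refine Finset.sum_congr rfl fun k _ => ?_
      ring
  change ∑ k, cplx z k * (starRingEnd ℂ) (cplx ξ k) = 0 ↔ _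
  rw [h]

theorem inner_cmul_left (w : ℂ) (x y : Space n) :
    inner ℝ (cmul w x) y = inner ℝ ((starRingEnd ℂ) (herm x y)) w := by
  rw [cmul_apply, inner_add_left, inner_smul_left, inner_smul_left, inner_mulI_left,
    Complex.inner]
  simp [herm]
  ring

theorem herm_add_left (x x' y : Space n) : herm (x + x') y = herm x y + herm x' y := by
  apply Complex.ext <;> simp [herm, inner_add_left]

theorem herm_smul_right (r : ℝ) (x y : Space n) : herm x (r • y) = r * herm x y := by
  apply Complex.ext <;> simp [herm, inner_smul_right]

theorem herm_cmul_self (w : ℂ) (x : Space n) :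
    herm (cmul w x) x = ((‖x‖ ^ 2 : ℝ) : ℂ) * w := by
  apply Complex.ext
  · rw [Complex.re_ofReal_mul]
    simp [herm, cmul_apply, inner_add_left, inner_smul_left, inner_mulI_left, inner_mulI_self]
    ring
  · rw [Complex.im_ofReal_mul]
    simp [herm, cmul_apply, inner_add_left, inner_smul_left, inner_mulI_self]
    ring

theorem inner_cmul_right_eq_zero {x y : Space n} (h : herm x y = 0) (w : ℂ) :
    inner ℝ x (cmul w y) = 0 := by
  have h1 : inner ℝ x y = 0 := congrArg Complex.re h
  have h2 : inner ℝ x (mulI y) = 0 := congrArg Complex.im h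
  simp [cmul_apply, inner_add_right, inner_smul_right, h1, h2]

theorem complexHyperplane_smul {r : ℝ} (hr : r ≠ 0) (y : Space n) :
    complexHyperplane (r • y) = complexHyperplane y := by
  ext z
  simp [mem_complexHyperplane_iff, herm_smul_right, hr]

/-- The complex line through a unit vector, parametrized isometrically. -/
def lineIsometry (e : Space n) (he : ‖e‖ = 1) : ℂ →ₗᵢ[ℝ] Space n where
  toFun w := cmul w e
  map_add' v w := by
    simp only [cmul_apply, Complex.add_re, Complex.add_im]
    module
  map_smul' c w := by
    simp only [cmul_apply, Complex.smul_re, Complex.smul_im, smul_eq_mul, RingHom.id_apply]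
    module
  norm_map' w := by
    change ‖cmul w e‖ = _
    rw [norm_cmul, he, mul_one]

theorem complexHyperplane_eq_orthogonal (e : Space n) (he : ‖e‖ = 1) :
    complexHyperplane e = (LinearMap.range (lineIsometry e he).toLinearMap)ᗮ := by
  ext z
  rw [mem_complexHyperplane_iff, Submodule.mem_orthogonal']
  constructor
  · rintro h _ ⟨w, rfl⟩
    exact inner_cmul_right_eq_zero h w
  · intro h
    have h1 := h _ ⟨1, rfl⟩
    have h2 := h _ ⟨Complex.I, rfl⟩
    change inner ℝ z (cmul 1 e) = 0 at h1
    change inner ℝ z (cmul Complex.I e) = 0 at h2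
    apply Complex.ext
    · exact (by simpa [cmul_apply] using h1 : inner ℝ z e = 0)
    · exact (by simpa [cmul_apply] using h2 : inner ℝ z (mulI e) = 0)

theorem finrank_complexHyperplane (e : Space n) (he : ‖e‖ = 1) :
    finrank ℝ (complexHyperplane e) = 2 * n - 2 := by
  have h := Submodule.finrank_add_finrank_orthogonal
    (LinearMap.range (lineIsometry e he).toLinearMap)
  rw [← complexHyperplane_eq_orthogonal, LinearMap.finrank_range_of_inj
    (lineIsometry e he).injective, Complex.finrank_real_complex, finrank_euclideanSpace] at h
  simp at h
  omega

/-! ### Isometric coordinates on complex hyperplanes -/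

/-- The model space for complex hyperplanes in `ℂⁿ`. -/
abbrev Model (n : ℕ) : Type := EuclideanSpace ℝ (Fin (2 * n - 2))

theorem exists_isometry_complexHyperplane (e : Space n) (he : ‖e‖ = 1) :
    ∃ L : Model n →ₗᵢ[ℝ] Space n, ∀ u, herm (L u) e = 0 := by
  refine ⟨(complexHyperplane e).subtypeₗᵢ.comp (((stdOrthonormalBasis ℝ (complexHyperplane e)).reindex
    (finCongr (finrank_complexHyperplane e he))).repr.symm.toLinearIsometry), fun u => ?_⟩
  rw [← mem_complexHyperplane_iff]
  exact Subtype.coe_prop _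

/-- The volume of a section may be computed in any isometric coordinates on the hyperplane. -/
theorem sectionVolume_eq (K : Set (Space n)) {e : Space n} (he : ‖e‖ = 1)
    (L : Model n →ₗᵢ[ℝ] Space n) (hL : ∀ u, herm (L u) e = 0) :
    sectionVolume K (complexHyperplane e) = volume.real (L ⁻¹' K) := by
  have hf : finrank ℝ (Model n) = finrank ℝ (complexHyperplane e) := by
    rw [finrank_complexHyperplane e he, finrank_euclideanSpace, Fintype.card_fin]
  let L' : Model n →ₗᵢ[ℝ] complexHyperplane e :=
    { toLinearMap := L.toLinearMap.codRestrict (complexHyperplane e)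
        fun u => (mem_complexHyperplane_iff _ _).2 (hL u)
      norm_map' := fun u => L.norm_map u }
  let Φ := L'.toLinearIsometryEquiv hf
  let _ : MeasureSpace (complexHyperplane e) := measureSpaceOfInnerProductSpace
  have hΦ : MeasurePreserving Φ volume volume := Φ.measurePreserving
  rw [sectionVolume, Measure.real, Measure.real,
    ← hΦ.measure_preimage_emb Φ.toHomeomorph.measurableEmbedding]
  rfl

/-- Orthogonal coordinates adapted to the splitting of `ℝ²ⁿ` into a complex hyperplane and the
orthogonal complex line preserve the volume. -/
theorem measurePreserving_add_cmul (hn : 1 ≤ n) {e : Space n} (he : ‖e‖ = 1)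
    (L : Model n →ₗᵢ[ℝ] Space n) (hL : ∀ u, herm (L u) e = 0) :
    MeasurePreserving (fun p : Model n × ℂ => L p.1 + cmul p.2 e) volume volume ∧
      MeasurableEmbedding (fun p : Model n × ℂ => L p.1 + cmul p.2 e) := by
  let Ψ : WithLp 2 (Model n × ℂ) →ₗᵢ[ℝ] Space n :=
    { toLinearMap := (L.toLinearMap.coprod (lineIsometry e he).toLinearMap) ∘ₗ
        (WithLp.linearEquiv 2 ℝ (Model n × ℂ)).toLinearMap
      norm_map' := fun p => by
        change ‖L p.fst + cmul p.snd e‖ = ‖p‖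
        rw [← sq_eq_sq₀ (norm_nonneg _) (norm_nonneg _), norm_add_sq_real,
          inner_cmul_right_eq_zero (hL _), norm_cmul, he, L.norm_map,
          WithLp.prod_norm_sq_eq_of_L2]
        simp }
  have hf : finrank ℝ (WithLp 2 (Model n × ℂ)) = finrank ℝ (Space n) := by
    rw [(WithLp.linearEquiv 2 ℝ (Model n × ℂ)).finrank_eq, Module.finrank_prod,
      finrank_euclideanSpace, finrank_euclideanSpace, Complex.finrank_real_complex]
    simp
    omega
  let Φ := Ψ.toLinearIsometryEquiv hf
  have h1 : (fun p : Model n × ℂ => L p.1 + cmul p.2 e) = Φ ∘ WithLp.toLp 2 := rfl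
  rw [h1]
  refine ⟨Φ.measurePreserving.comp (WithLp.volume_preserving_toLp _ _), ?_⟩
  exact Φ.toHomeomorph.measurableEmbedding.comp
    (MeasurableEquiv.toLp 2 (Model n × ℂ)).measurableEmbedding

/-! ### Volumes of moving sections -/

section MovingSections

variable {V W : Type*} [NormedAddCommGroup V] [InnerProductSpace ℝ V] [FiniteDimensional ℝ V]
  [NormedAddCommGroup W] [InnerProductSpace ℝ W]

/-- Linear isometries between finite-dimensional spaces form a sequentially compact set. -/
theorem exists_subseq_tendsto_isometry [FiniteDimensional ℝ W] (A : ℕ → V →ₗᵢ[ℝ] W) :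
    ∃ (L : V →ₗᵢ[ℝ] W) (φ : ℕ → ℕ), StrictMono φ ∧
      ∀ u, Tendsto (fun k => A (φ k) u) atTop (𝓝 (L u)) := by
  have : ProperSpace (V →L[ℝ] W) := FiniteDimensional.proper ℝ _
  obtain ⟨B, -, φ, hφ, hB⟩ := (isCompact_closedBall (0 : V →L[ℝ] W) 1).tendsto_subseq
    (x := fun k => (A k).toContinuousLinearMap) fun k => by
      simpa using (A k).norm_toContinuousLinearMap_le
  have hB' : ∀ u, Tendsto (fun k => A (φ k) u) atTop (𝓝 (B u)) := fun u =>
    ((ContinuousLinearMap.apply ℝ W u).continuous.tendsto B).comp hB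
  refine ⟨⟨B.toLinearMap, fun u => ?_⟩, φ, hφ, hB'⟩
  refine tendsto_nhds_unique (hB' u).norm ?_
  simp

variable [MeasurableSpace V] [BorelSpace V]

theorem mem_iff_gauge_le_one (K : ConvexBody W) (hK : (K : Set W) ∈ 𝓝 0) (x : W) :
    x ∈ (K : Set W) ↔ gauge (K : Set W) x ≤ 1 := by
  rw [gauge_le_one_iff_mem_closure K.convex hK, K.isClosed.closure_eq]

theorem exists_pos_subset_closedBall (K : ConvexBody W) :
    ∃ R > 0, (K : Set W) ⊆ Metric.closedBall 0 R := by
  obtain ⟨R, hR⟩ := K.isBounded.subset_closedBall 0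
  exact ⟨max R 1, by positivity, hR.trans (Metric.closedBall_subset_closedBall (le_max_left _ _))⟩

/-- The relative boundary of a central section of a convex body is negligible. -/
theorem volume_gauge_comp_eq_one (K : ConvexBody W) (hK : (K : Set W) ∈ 𝓝 0) (L : V →ₗᵢ[ℝ] W) :
    volume {u : V | gauge (K : Set W) (L u) = 1} = 0 := by
  have hc : Convex ℝ (L ⁻¹' (K : Set W)) := K.convex.linear_preimage L.toLinearMap
  have h0 : L ⁻¹' (K : Set W) ∈ 𝓝 0 := L.continuous.continuousAt (by simpa using hK)
  have hg : ∀ u, gauge (K : Set W) (L u) = gauge (L ⁻¹' (K : Set W)) u := fun u => by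
    simp [gauge_def']
  simp only [hg, gauge_eq_one_iff_mem_frontier hc h0]
  exact hc.addHaar_frontier volume

/-- The volume of a section of a convex body depends continuously on the section, near sections
through an interior point. -/
theorem tendsto_volume_section {ι : Type*} {l : Filter ι} [l.IsCountablyGenerated]
    (K : ConvexBody W) (hK : (K : Set W) ∈ 𝓝 0) (A : ι → V →ₗᵢ[ℝ] W) (v : ι → W)
    (L : V →ₗᵢ[ℝ] W) (hA : ∀ u, Tendsto (fun k => A k u) l (𝓝 (L u)))
    (hv : Tendsto v l (𝓝 0)) :
    Tendsto (fun k => volume.real {u | A k u + v k ∈ (K : Set W)}) l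
      (𝓝 (volume.real (L ⁻¹' (K : Set W)))) := by
  obtain ⟨R, -, hR⟩ := exists_pos_subset_closedBall K
  have hm : ∀ k, MeasurableSet {u | A k u + v k ∈ (K : Set W)} := fun k =>
    (K.isClosed.preimage (f := fun u => A k u + v k)
      ((A k).continuous.add continuous_const)).measurableSet
  have hm' : MeasurableSet (L ⁻¹' (K : Set W)) := (K.isClosed.preimage L.continuous).measurableSet
  have hi : ∀ {s : Set V}, MeasurableSet s → volume.real s = ∫ u, s.indicator (1 : V → ℝ) u :=
    fun hs => (integral_indicator_one hs).symm
  simp only [hi (hm _), hi hm']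
  refine tendsto_integral_filter_of_dominated_convergence
    ((Metric.closedBall (0 : V) (R + 1)).indicator 1) ?_ ?_ ?_ ?_
  · exact Eventually.of_forall fun k => (measurable_one.indicator (hm k)).aestronglyMeasurable
  · filter_upwards [hv (Metric.closedBall_mem_nhds 0 one_pos)] with k hk
    refine Eventually.of_forall fun u => ?_
    by_cases hu : A k u + v k ∈ (K : Set W)
    · have h1 : ‖A k u + v k‖ ≤ R := by simpa using hR hu
      have h2 : ‖v k‖ ≤ 1 := by simpa using hk
      have h3 : ‖u‖ ≤ R + 1 := by
        rw [← (A k).norm_map u]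
        calc ‖A k u‖ = ‖(A k u + v k) - v k‖ := by simp
          _ ≤ R + 1 := (norm_sub_le _ _).trans (add_le_add h1 h2)
      rw [Set.indicator_of_mem (by exact hu), Set.indicator_of_mem (by simpa using h3)]
      simp
    · rw [Set.indicator_of_notMem (by exact hu), norm_zero]
      exact Set.indicator_nonneg (fun _ _ => zero_le_one) _
  · exact (integrable_indicator_iff Metric.isClosed_closedBall.measurableSet).2
      (integrableOn_const (isCompact_closedBall _ _).measure_lt_top.ne)
  · have hae : ∀ᵐ u : V, gauge (K : Set W) (L u) ≠ 1 := by
      rw [ae_iff]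
      simpa using volume_gauge_comp_eq_one K hK L
    filter_upwards [hae] with u hu
    have ht : Tendsto (fun k => gauge (K : Set W) (A k u + v k)) l
        (𝓝 (gauge (K : Set W) (L u))) := by
      have := (hA u).add hv
      rw [add_zero] at this
      exact ((continuous_gauge K.convex hK).tendsto _).comp this
    refine tendsto_const_nhds.congr' ?_
    rcases lt_or_gt_of_ne hu with h | h
    · filter_upwards [ht.eventually_lt_const h] with k hk
      rw [Set.indicator_of_mem (show u ∈ L ⁻¹' (K : Set W) from (mem_iff_gauge_le_one K hK _).2 h.le),
        Set.indicator_of_mem (show u ∈ {u | A k u + v k ∈ (K : Set W)} from (mem_iff_gauge_le_one K hK _).2 hk.le)]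
    · filter_upwards [ht.eventually_const_lt h] with k hk
      rw [Set.indicator_of_notMem (show u ∉ L ⁻¹' (K : Set W) from
          fun h' => h.not_ge ((mem_iff_gauge_le_one K hK _).1 h')),
        Set.indicator_of_notMem (show u ∉ {u | A k u + v k ∈ (K : Set W)} from
          fun h' => hk.not_ge ((mem_iff_gauge_le_one K hK _).1 h'))]

end MovingSections

/-- The volume of the section by the complex hyperplane orthogonal to `y` is continuous in `y`. -/
theorem continuousOn_sectionVolume (K : ConvexBody (Space n))
    (hK : (K : Set (Space n)) ∈ 𝓝 0) :
    ContinuousOn (fun y => sectionVolume (K : Set (Space n)) (complexHyperplane y)) {0}ᶜ := by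
  have hs : ContinuousOn (fun y => sectionVolume (K : Set (Space n)) (complexHyperplane y))
      (Metric.sphere 0 1) := by
    rw [continuousOn_iff_continuous_domRestrict, continuous_iff_seqContinuous]
    intro x y hxy
    have hx1 : ∀ k, ‖(x k : Space n)‖ = 1 := fun k => norm_eq_of_mem_sphere (x k)
    have hy1 : ‖(y : Space n)‖ = 1 := norm_eq_of_mem_sphere y
    choose A hA using fun k => exists_isometry_complexHyperplane (x k : Space n) (hx1 k)
    refine tendsto_of_subseq_tendsto fun ns hns => ?_
    obtain ⟨L, φ, hφ, hL⟩ := exists_subseq_tendsto_isometry fun k => A (ns k)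
    have hsub : Tendsto (fun k => (x (ns (φ k)) : Space n)) atTop (𝓝 (y : Space n)) :=
      (continuous_subtype_val.tendsto y).comp (hxy.comp (hns.comp hφ.tendsto_atTop))
    have hLy : ∀ u, herm (L u) y = 0 := fun u => by
      refine tendsto_nhds_unique
        ((continuous_herm.tendsto (L u, (y : Space n))).comp ((hL u).prodMk_nhds hsub)) ?_
      refine tendsto_const_nhds.congr fun k => ?_
      exact (hA _ _).symm
    refine ⟨φ, ?_⟩
    have := tendsto_volume_section K hK (fun k => A (ns (φ k))) (fun _ => 0) L hL
      tendsto_const_nhds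
    simp only [add_zero] at this
    simp only [Set.domRestrict_apply, Function.comp_apply]
    rw [sectionVolume_eq _ hy1 L hLy]
    refine this.congr fun k => ?_
    rw [sectionVolume_eq _ (hx1 _) _ (hA _)]
    rfl
  have hnorm : ContinuousOn (fun y : Space n => ‖y‖⁻¹ • y) {0}ᶜ :=
    (continuousOn_id.norm.inv₀ fun y hy => norm_ne_zero_iff.2 hy).smul continuousOn_id
  refine (hs.comp hnorm fun y hy => ?_).congr fun y hy => ?_
  · have hy' : ‖y‖ ≠ 0 := norm_ne_zero_iff.2 hy
    simp [norm_smul, hy']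
  · have hy' : ‖y‖ ≠ 0 := norm_ne_zero_iff.2 hy
    simp only [Function.comp_apply, complexHyperplane_smul (inv_ne_zero hy')]

/-! ### Gaussian averages over parallel sections -/

/-- The average of the body `K` against the Gaussian density of width `s` (up to the factor
`4π²`) in the variable `∑ₖ xₖ * conj yₖ`; as `s → 0` it concentrates on the hyperplane
orthogonal to `y`. -/
def gaussianSection (K : Set (Space n)) (s : ℝ) (y : Space n) : ℝ :=
  ∫ x in K, 2 * Real.pi / s ^ 2 * Real.exp (-(‖herm x y‖ ^ 2 / (2 * s ^ 2)))

/-- The volume of the section of `K` by the translate of a complex hyperplane, in isometric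
coordinates. -/
def parallelSection (K : Set (Space n)) (L : Model n →ₗᵢ[ℝ] Space n) (e : Space n) (w : ℂ) : ℝ :=
  volume.real {u | L u + cmul w e ∈ K}

/-- In orthogonal coordinates `x = L u + w e` the Hermitian product with `r e` is `r w`, so that the
Gaussian average is an average of the volumes of parallel sections, here rescaled by `s / r`. -/
theorem gaussianSection_eq (hn : 1 ≤ n) (K : ConvexBody (Space n)) {s r : ℝ} (hs : 0 < s)
    (hr : 0 < r) {e : Space n} (he : ‖e‖ = 1) (L : Model n →ₗᵢ[ℝ] Space n)
    (hL : ∀ u, herm (L u) e = 0) :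
    gaussianSection (K : Set (Space n)) s (r • e) = (r ^ 2)⁻¹ *
      ∫ w : ℂ, 2 * Real.pi * Real.exp (-(1 / 2) * ‖w‖ ^ 2) *
        parallelSection (K : Set (Space n)) L e ((s / r) • w) := by
  obtain ⟨hmp, hme⟩ := measurePreserving_add_cmul hn he L hL
  set F : ℂ → ℝ := fun w => 2 * Real.pi / s ^ 2 * Real.exp (-(r ^ 2 * ‖w‖ ^ 2 / (2 * s ^ 2))) *
    parallelSection (K : Set (Space n)) L e w with hF
  have hK : MeasurableSet (K : Set (Space n)) := K.isClosed.measurableSet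
  have hherm : ∀ p : Model n × ℂ, herm (L p.1 + cmul p.2 e) (r • e) = r * p.2 := fun p => by
    rw [herm_smul_right, herm_add_left, hL, herm_cmul_self, he]
    simp
  have hint : IntegrableOn (fun x : Space n =>
      2 * Real.pi / s ^ 2 * Real.exp (-(‖herm x (r • e)‖ ^ 2 / (2 * s ^ 2)))) K := by
    refine ContinuousOn.integrableOn_compact K.isCompact (Continuous.continuousOn ?_)
    have : Continuous fun x : Space n => herm x (r • e) :=
      continuous_herm.comp (continuous_id.prodMk continuous_const)
    fun_prop
  have h1 : gaussianSection (K : Set (Space n)) s (r • e) = ∫ w, F w := by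
    rw [gaussianSection, ← integral_indicator hK, ← hmp.integral_comp hme]
    rw [← integrable_indicator_iff hK, ← hmp.integrable_comp_emb hme] at hint
    rw [Measure.volume_eq_prod] at hint ⊢
    refine (integral_prod_symm _ hint).trans ?_
    refine integral_congr_ae (Eventually.of_forall fun w => ?_)
    have hm : MeasurableSet {u : Model n | L u + cmul w e ∈ (K : Set (Space n))} :=
      (K.isClosed.preimage (f := fun u => L u + cmul w e)
        (L.continuous.add continuous_const)).measurableSet
    simp only [hF, parallelSection]
    rw [← integral_indicator_one hm, ← integral_const_mul]
    refine integral_congr_ae (Eventually.of_forall fun u => ?_)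
    by_cases hu : L u + cmul w e ∈ (K : Set (Space n))
    · beta_reduce
      rw [Function.comp_apply]
      have hu' : u ∈ {u : Model n | L u + cmul w e ∈ (K : Set (Space n))} := hu
      simp only [Set.indicator_of_mem hu, Set.indicator_of_mem hu', hherm (u, w)]
      simp [mul_pow]
    · beta_reduce
      rw [Function.comp_apply]
      have hu' : u ∉ {u : Model n | L u + cmul w e ∈ (K : Set (Space n))} := hu
      simp only [Set.indicator_of_notMem hu, Set.indicator_of_notMem hu', mul_zero]
  have h2 := Measure.integral_comp_smul (volume : Measure ℂ) F (s / r)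
  rw [Complex.finrank_real_complex, abs_of_nonneg (by positivity), smul_eq_mul] at h2
  have h3 : ∫ w, F w = (s / r) ^ 2 * ∫ w, F ((s / r) • w) := by
    rw [h2, ← mul_assoc, mul_inv_cancel₀ (by positivity), one_mul]
  rw [h1, h3, ← integral_const_mul, ← integral_const_mul]
  refine integral_congr_ae (Eventually.of_forall fun w => ?_)
  have h4 : r ^ 2 * ‖(s / r) • w‖ ^ 2 / (2 * s ^ 2) = 1 / 2 * ‖w‖ ^ 2 := by
    rw [norm_smul, Real.norm_of_nonneg (by positivity)]
    field_simp
  simp only [hF, h4]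
  rw [neg_mul]
  field_simp

theorem integral_gaussian_complex :
    ∫ w : ℂ, 2 * Real.pi * Real.exp (-(1 / 2) * ‖w‖ ^ 2) = 4 * Real.pi ^ 2 := by
  rw [integral_const_mul, GaussianFourier.integral_rexp_neg_mul_sq_norm (by norm_num),
    Complex.finrank_real_complex]
  norm_num
  ring

theorem integrable_gaussian_complex {b : ℝ} (hb : 0 < b) :
    Integrable fun w : ℂ => Real.exp (-b * ‖w‖ ^ 2) := by
  by_contra h
  have h1 := GaussianFourier.integral_rexp_neg_mul_sq_norm (V := ℂ) hb
  rw [integral_undef h, Complex.finrank_real_complex] at h1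
  have : 0 < Real.pi / b := by positivity
  exact (Real.rpow_pos_of_pos this _).ne h1

theorem parallelSection_le {K : Set (Space n)} {R : ℝ} (hR : K ⊆ Metric.closedBall 0 R)
    (L : Model n →ₗᵢ[ℝ] Space n) {e : Space n} (hL : ∀ u, herm (L u) e = 0) (w : ℂ) :
    parallelSection K L e w ≤ volume.real (Metric.closedBall (0 : Model n) R) := by
  refine measureReal_mono (fun u hu => ?_) (isCompact_closedBall _ _).measure_lt_top.ne
  have h1 : ‖L u + cmul w e‖ ≤ R := by simpa using hR hu
  have h2 := norm_add_sq_real (L u) (cmul w e)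
  rw [inner_cmul_right_eq_zero (hL u), L.norm_map] at h2
  have h3 : ‖u‖ ≤ ‖L u + cmul w e‖ := by
    rw [← sq_le_sq₀ (norm_nonneg _) (norm_nonneg _), h2]
    nlinarith [sq_nonneg ‖cmul w e‖]
  simpa using h3.trans h1

theorem measurable_parallelSection (K : ConvexBody (Space n)) (L : Model n →ₗᵢ[ℝ] Space n)
    (e : Space n) : Measurable (parallelSection (K : Set (Space n)) L e) := by
  have h : Continuous fun p : Model n × ℂ => L p.1 + cmul p.2 e :=
    (L.continuous.comp continuous_fst).add
      (continuous_cmul.comp (continuous_snd.prodMk continuous_const))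
  exact (measurable_measure_prodMk_right (μ := (volume : Measure (Model n)))
    (K.isClosed.preimage h).measurableSet).ennreal_toReal

theorem exists_smul_unit {y : Space n} (hy : y ≠ 0) :
    ∃ e : Space n, ‖e‖ = 1 ∧ y = ‖y‖ • e := by
  have hy' : ‖y‖ ≠ 0 := norm_ne_zero_iff.2 hy
  exact ⟨‖y‖⁻¹ • y, by simp [norm_smul, hy'], by rw [smul_inv_smul₀ hy']⟩

theorem gaussianSection_nonneg (K : Set (Space n)) (s : ℝ) (y : Space n) :
    0 ≤ gaussianSection K s y :=
  integral_nonneg fun _ => by positivity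

/-- The bound is uniform in the width of the Gaussian. -/
theorem exists_gaussianSection_le (hn : 1 ≤ n) (K : ConvexBody (Space n)) :
    ∃ C, ∀ s > 0, ∀ y ≠ 0, gaussianSection (K : Set (Space n)) s y ≤ C * (‖y‖ ^ 2)⁻¹ := by
  obtain ⟨R, -, hR⟩ := exists_pos_subset_closedBall K
  refine ⟨4 * Real.pi ^ 2 * volume.real (Metric.closedBall (0 : Model n) R), fun s hs y hy => ?_⟩
  obtain ⟨e, he, hye⟩ := exists_smul_unit hy
  obtain ⟨L, hL⟩ := exists_isometry_complexHyperplane e he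
  have hr : 0 < ‖y‖ := norm_pos_iff.2 hy
  have heq := gaussianSection_eq hn K hs hr he L hL
  rw [← hye] at heq
  rw [heq, mul_comm]
  refine mul_le_mul_of_nonneg_right ?_ (by positivity)
  rw [← integral_gaussian_complex, ← integral_mul_const]
  refine integral_mono_of_nonneg (Eventually.of_forall fun w => ?_) ?_
    (Eventually.of_forall fun w => ?_)
  · exact mul_nonneg (by positivity) measureReal_nonneg
  · exact ((integrable_gaussian_complex (by norm_num)).const_mul _).mul_const _
  · exact mul_le_mul_of_nonneg_left (parallelSection_le hR L hL _) (by positivity)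

theorem tendsto_gaussianSection (hn : 1 ≤ n) (K : ConvexBody (Space n))
    (hK : (K : Set (Space n)) ∈ 𝓝 0) {y : Space n} (hy : y ≠ 0) :
    Tendsto (fun s => gaussianSection (K : Set (Space n)) s y) (𝓝[>] 0)
      (𝓝 (4 * Real.pi ^ 2 * (‖y‖ ^ 2)⁻¹ *
        sectionVolume (K : Set (Space n)) (complexHyperplane y))) := by
  obtain ⟨R, -, hR⟩ := exists_pos_subset_closedBall K
  obtain ⟨e, he, hye⟩ := exists_smul_unit hy
  obtain ⟨L, hL⟩ := exists_isometry_complexHyperplane e he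
  have hr : 0 < ‖y‖ := norm_pos_iff.2 hy
  have hH : complexHyperplane y = complexHyperplane e := by
    conv_lhs => rw [hye]
    exact complexHyperplane_smul hr.ne' e
  have key : Tendsto (fun s : ℝ => ∫ w : ℂ, 2 * Real.pi * Real.exp (-(1 / 2) * ‖w‖ ^ 2) *
      parallelSection (K : Set (Space n)) L e ((s / ‖y‖) • w)) (𝓝[>] 0)
      (𝓝 (∫ w : ℂ, 2 * Real.pi * Real.exp (-(1 / 2) * ‖w‖ ^ 2) *
        volume.real (L ⁻¹' (K : Set (Space n))))) := by
    refine tendsto_integral_filter_of_dominated_convergence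
      (fun w => 2 * Real.pi * Real.exp (-(1 / 2) * ‖w‖ ^ 2) *
        volume.real (Metric.closedBall (0 : Model n) R)) ?_ ?_ ?_ ?_
    · refine Eventually.of_forall fun s => Measurable.aestronglyMeasurable ?_
      have := measurable_parallelSection K L e
      fun_prop
    · refine Eventually.of_forall fun s => Eventually.of_forall fun w => ?_
      rw [Real.norm_of_nonneg (mul_nonneg (by positivity) (by exact measureReal_nonneg))]
      exact mul_le_mul_of_nonneg_left (parallelSection_le hR L hL _) (by positivity)
    · exact ((integrable_gaussian_complex (by norm_num)).const_mul _).mul_const _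
    · refine Eventually.of_forall fun w => Tendsto.const_mul _ ?_
      refine tendsto_volume_section K hK (fun _ => L) _ L (fun _ => tendsto_const_nhds) ?_
      have h : Continuous fun s : ℝ => cmul ((s / ‖y‖) • w) e :=
        continuous_cmul.comp (((continuous_id.div_const _).smul continuous_const).prodMk
          continuous_const)
      have h0 := h.tendsto 0
      rw [zero_div, zero_smul, ← Complex.ofReal_zero, cmul_ofReal, zero_smul] at h0
      exact h0.mono_left nhdsWithin_le_nhds
  rw [integral_mul_const, integral_gaussian_complex] at key
  rw [hH, sectionVolume_eq _ he L hL, mul_comm (4 * Real.pi ^ 2), mul_assoc]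
  refine (key.const_mul (‖y‖ ^ 2)⁻¹).congr' ?_
  filter_upwards [self_mem_nhdsWithin] with s hs
  rw [← gaussianSection_eq hn K hs hr he L hL, ← hye]

/-! ### Integrability of homogeneous singularities -/

section Singularities

variable {E : Type*} [NormedAddCommGroup E] [InnerProductSpace ℝ E] [FiniteDimensional ℝ E]
  [MeasurableSpace E] [BorelSpace E]

theorem integrable_inv_norm_pow_mul {k : ℕ} (hk : k < finrank ℝ E) :
    Integrable fun x : E => (‖x‖ ^ k)⁻¹ * (1 + ‖x‖) ^ (-((finrank ℝ E + 1 : ℕ) : ℝ)) := by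
  have : Nontrivial E := Module.nontrivial_of_finrank_pos (R := ℝ) (by omega)
  have h := integrable_fun_norm_addHaar (E := E) volume
    (f := fun r : ℝ => (r ^ k)⁻¹ * (1 + r) ^ (-((finrank ℝ E + 1 : ℕ) : ℝ)))
  refine h.2 ?_
  have h2 : Integrable fun r : ℝ => (1 + ‖r‖) ^ (-(2 : ℝ)) :=
    integrable_one_add_norm (by simp)
  refine (h2.integrableOn (s := Set.Ioi 0)).mono' ?_ ?_
  · exact Measurable.aestronglyMeasurable (by fun_prop)
  · refine (ae_restrict_iff' measurableSet_Ioi).2 (Eventually.of_forall fun r hr => ?_)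
    have hr : 0 < r := hr
    obtain ⟨j, hj⟩ : ∃ j, finrank ℝ E = k + j + 1 := ⟨finrank ℝ E - k - 1, by omega⟩
    rw [Real.norm_of_nonneg (by positivity), Real.norm_of_nonneg hr.le, smul_eq_mul, hj,
      Real.rpow_neg (by positivity), Real.rpow_neg (by positivity), Real.rpow_natCast]
    have h3 : r ^ j ≤ (1 + r) ^ (k + j) :=
      (pow_le_pow_left₀ hr.le (by linarith) j).trans
        (pow_le_pow_right₀ (by linarith) (by omega))
    have h4 : r ^ (k + j + 1 - 1) * ((r ^ k)⁻¹ * ((1 + r) ^ (k + j + 1 + 1))⁻¹) =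
        r ^ j * ((1 + r) ^ (k + j + 1 + 1))⁻¹ := by
      rw [Nat.add_sub_cancel, pow_add]
      field_simp
    rw [h4]
    calc r ^ j * ((1 + r) ^ (k + j + 1 + 1))⁻¹
        ≤ (1 + r) ^ (k + j) * ((1 + r) ^ (k + j + 1 + 1))⁻¹ := by gcongr
      _ = ((1 + r) ^ (2 : ℝ))⁻¹ := by
        rw [Real.rpow_ofNat, pow_succ, pow_succ]
        field_simp

/-- A singularity of order less than the dimension is integrable against Schwartz functions. -/
theorem integrable_inv_norm_pow_mul_schwartz {k : ℕ} (hk : k < finrank ℝ E) (φ : 𝓢(E, ℂ)) :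
    Integrable fun x : E => (‖x‖ ^ k)⁻¹ * ‖φ x‖ := by
  set N := finrank ℝ E + 1 with hN
  set C := 2 ^ N * ((Finset.Iic (N, 0)).sup fun m => SchwartzMap.seminorm ℝ m.1 m.2) φ
  refine ((integrable_inv_norm_pow_mul hk).const_mul C).mono' ?_ (Eventually.of_forall fun x => ?_)
  · have : Measurable fun x => ‖φ x‖ := φ.continuous.norm.measurable
    exact Measurable.aestronglyMeasurable (by fun_prop)
  · have h := SchwartzMap.one_add_le_sup_seminorm_apply (𝕜 := ℝ) (m := (N, 0)) (k := N) (n := 0)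
      le_rfl le_rfl φ x
    rw [norm_iteratedFDeriv_zero] at h
    rw [Real.norm_of_nonneg (by positivity), Real.rpow_neg (by positivity), Real.rpow_natCast,
      mul_left_comm]
    gcongr
    rw [← div_eq_mul_inv, le_div_iff₀' (by positivity)]
    exact h

end Singularities

theorem inv_gauge_pow_le {K : Set (Space n)} (hK : K ∈ 𝓝 0) {R : ℝ} (hR0 : 0 < R)
    (hR : K ⊆ Metric.closedBall 0 R) {k : ℕ} (hk : k ≠ 0) (x : Space n) :
    (gauge K x ^ k)⁻¹ ≤ R ^ k * (‖x‖ ^ k)⁻¹ := by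
  rcases eq_or_ne x 0 with rfl | hx
  · simp [hk]
  · have hx' : 0 < ‖x‖ := norm_pos_iff.2 hx
    have h := le_gauge_of_subset_closedBall (absorbent_nhds_zero hK) hR0.le hR (x := x)
    calc (gauge K x ^ k)⁻¹ ≤ ((‖x‖ / R) ^ k)⁻¹ := by gcongr
      _ = R ^ k * (‖x‖ ^ k)⁻¹ := by rw [div_pow, inv_div, div_eq_mul_inv]

/-! ### Integration over complex lines -/

theorem measurePreserving_cmul {w : ℂ} (hw : ‖w‖ = 1) :
    MeasurePreserving (cmul (n := n) w) volume volume ∧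
      MeasurableEmbedding (cmul (n := n) w) := by
  let U : Space n →ₗᵢ[ℝ] Space n :=
    ⟨(cmul w).toLinearMap, fun x => (norm_cmul w x).trans (by rw [hw, one_mul])⟩
  let Φ := U.toLinearIsometryEquiv rfl
  exact ⟨Φ.measurePreserving, Φ.toHomeomorph.measurableEmbedding⟩

theorem cmul_eq_cmul_unit_smul {w : ℂ} (hw : w ≠ 0) (x : Space n) :
    cmul w x = cmul (w / ‖w‖) (‖w‖ • x) := by
  have hw' : (‖w‖ : ℂ) ≠ 0 := by simpa using hw
  rw [← cmul_ofReal, ← cmul_mul, div_mul_cancel₀ _ hw']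

theorem norm_div_norm_self {w : ℂ} (hw : w ≠ 0) : ‖w / ‖w‖‖ = 1 := by
  have hw' : ‖w‖ ≠ 0 := norm_ne_zero_iff.2 hw
  simp [hw']

/-- Complex scalars act on the volume of `ℂⁿ` as real scalars of the same modulus. -/
theorem integral_comp_cmul {F : Type*} [NormedAddCommGroup F] [NormedSpace ℝ F]
    (f : Space n → F) {w : ℂ} (hw : w ≠ 0) :
    ∫ x, f (cmul w x) = (‖w‖ ^ (2 * n))⁻¹ • ∫ x, f x := by
  obtain ⟨h1, h2⟩ := measurePreserving_cmul (n := n) (norm_div_norm_self hw)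
  have h3 : finrank ℝ (Space n) = 2 * n := by
    simp [mul_comm]
  simp only [cmul_eq_cmul_unit_smul hw]
  rw [Measure.integral_comp_smul volume (fun x => f (cmul (w / ‖w‖) x)) ‖w‖,
    h1.integral_comp h2, h3, abs_of_nonneg (by positivity)]

theorem integrable_comp_cmul {F : Type*} [NormedAddCommGroup F]
    {f : Space n → F} (hf : Integrable f) {w : ℂ} (hw : w ≠ 0) :
    Integrable fun x => f (cmul w x) := by
  obtain ⟨h1, h2⟩ := measurePreserving_cmul (n := n) (norm_div_norm_self hw)
  simp only [cmul_eq_cmul_unit_smul hw]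
  exact (integrable_comp_smul_iff volume (fun x => f (cmul (w / ‖w‖) x))
    (norm_ne_zero_iff.2 hw)).2 ((h1.integrable_comp_emb h2).2 hf)

/-- The radial integral which turns the indicator of a body into a power of its Minkowski
functional. -/
theorem integral_radial (hn : 2 ≤ n) {a : ℝ} (ha : 0 < a) :
    Integrable (fun w : ℂ => (Set.Ici a).indicator (fun r => (r ^ (2 * n))⁻¹) ‖w‖) ∧
      ∫ w : ℂ, (Set.Ici a).indicator (fun r => (r ^ (2 * n))⁻¹) ‖w‖ =
        2 * Real.pi / (2 * n - 2) * (a ^ (2 * n - 2))⁻¹ := by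
  have hn' : (2 : ℝ) ≤ n := by exact_mod_cast hn
  have hexp : -(2 * n - 1 : ℝ) < -1 := by linarith
  have hfun : ∀ r ∈ Set.Ioi (0 : ℝ), r ^ (finrank ℝ ℂ - 1) •
      (Set.Ici a).indicator (fun r => (r ^ (2 * n))⁻¹) r =
      (Set.Ici a).indicator (fun r => r ^ (-(2 * n - 1 : ℝ))) r := by
    intro r hr
    have hr : 0 < r := hr
    by_cases h : r ∈ Set.Ici a
    · have : (2 * n - 1 : ℝ) = (2 * n - 1 : ℕ) := by
        rw [Nat.cast_sub (by omega)]
        push_cast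
        ring
      rw [Set.indicator_of_mem h, Set.indicator_of_mem h, this, Real.rpow_neg hr.le,
        Real.rpow_natCast, Complex.finrank_real_complex, smul_eq_mul]
      obtain ⟨j, hj⟩ : ∃ j, 2 * n = j + 1 := ⟨2 * n - 1, by omega⟩
      rw [hj, Nat.add_sub_cancel, pow_succ]
      field_simp
      ring
    · simp [h]
  have hIci : Set.Ioi (0 : ℝ) ∩ Set.Ici a = Set.Ici a :=
    Set.inter_eq_right.2 fun r hr => ha.trans_le hr
  constructor
  · refine (integrable_fun_norm_addHaar (E := ℂ) volume).2 ?_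
    rw [integrableOn_congr_fun hfun measurableSet_Ioi]
    refine Integrable.integrableOn ?_
    rw [integrable_indicator_iff measurableSet_Ici, integrableOn_Ici_iff_integrableOn_Ioi]
    exact integrableOn_Ioi_rpow_of_lt hexp ha
  · rw [integral_fun_norm_addHaar (E := ℂ) volume, setIntegral_congr_fun measurableSet_Ioi hfun,
      setIntegral_indicator measurableSet_Ici, hIci, integral_Ici_eq_integral_Ioi,
      integral_Ioi_rpow_of_lt hexp ha, Measure.real, Complex.volume_ball,
      Complex.finrank_real_complex]
    have h1 : (-(2 * n - 1) + 1 : ℝ) = -((2 * n - 2 : ℕ) : ℝ) := by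
      rw [Nat.cast_sub (by omega)]
      push_cast
      ring
    have h2 : ((2 * n - 2 : ℕ) : ℝ) = 2 * n - 2 := by
      rw [Nat.cast_sub (by omega)]
      push_cast
      ring
    have h3 : (2 * n - 2 : ℝ) ≠ 0 := by linarith
    rw [h1, Real.rpow_neg ha.le, Real.rpow_natCast, h2, neg_div_neg_eq]
    simp
    field_simp

/-- Integration in polar coordinates on complex lines: the integrals over the complex lines
through the points of a rotation invariant body recover the integral against the power
`2 - 2n` of the Minkowski functional. -/
theorem integral_complex_lines (hn : 2 ≤ n) (K : ConvexBody (Space n))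
    (hK : (K : Set (Space n)) ∈ 𝓝 0) (hrot : IsRotationInvariant (K : Set (Space n)))
    {ψ : Space n → ℂ} (hψ : Continuous ψ)
    (hψi : Integrable fun x => (gauge (K : Set (Space n)) x ^ (2 * n - 2))⁻¹ * ‖ψ x‖) :
    Integrable (fun p : Space n × ℂ =>
      (K : Set (Space n)).indicator (fun x => ψ (cmul p.2 x)) p.1) ∧
    ∫ p : Space n × ℂ, (K : Set (Space n)).indicator (fun x => ψ (cmul p.2 x)) p.1 =
      ((2 * Real.pi / (2 * n - 2) : ℝ) : ℂ) *
        ∫ x, ((gauge (K : Set (Space n)) x ^ (2 * n - 2))⁻¹ : ℝ) * ψ x := by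
  have hnt : Nontrivial (Space n) :=
    Module.nontrivial_of_finrank_pos (R := ℝ) (by simp; omega)
  have hgc := continuous_gauge K.convex hK
  -- The integrand after the substitution `x ↦ w⁻¹ x` for fixed `w`, without the Jacobian: `G` is
  -- integrable because its integral over `w` is explicit.
  set G : Space n × ℂ → ℂ := fun p =>
    (((Set.Ici (gauge (K : Set (Space n)) p.1)).indicator (fun r => (r ^ (2 * n))⁻¹) ‖p.2‖ : ℝ) : ℂ)
      * ψ p.1 with hG
  have hind0 : ∀ (a b : ℝ), 0 ≤ b → 0 ≤ (Set.Ici a).indicator (fun r => (r ^ (2 * n))⁻¹) b :=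
    fun a b hb => by
      by_cases h : b ∈ Set.Ici a
      · rw [Set.indicator_of_mem h]; positivity
      · rw [Set.indicator_of_notMem h]
  have hnG : ∀ p, ‖G p‖ = (Set.Ici (gauge (K : Set (Space n)) p.1)).indicator
      (fun r => (r ^ (2 * n))⁻¹) ‖p.2‖ * ‖ψ p.1‖ := fun p => by
    rw [hG, norm_mul, Complex.norm_real, Real.norm_of_nonneg (hind0 _ _ (norm_nonneg _))]
  have hGm : Measurable G := by
    have h1 : MeasurableSet {p : Space n × ℂ | gauge (K : Set (Space n)) p.1 ≤ ‖p.2‖} :=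
      (isClosed_le (hgc.comp continuous_fst) continuous_snd.norm).measurableSet
    have h2 : Measurable fun p : Space n × ℂ => {p : Space n × ℂ |
        gauge (K : Set (Space n)) p.1 ≤ ‖p.2‖}.indicator (fun p => (‖p.2‖ ^ (2 * n))⁻¹) p :=
      Measurable.indicator (by fun_prop) h1
    have h3 : Measurable fun p : Space n × ℂ => ψ p.1 := hψ.measurable.comp measurable_fst
    exact (Complex.measurable_ofReal.comp h2).mul h3
  have hgpos : ∀ x : Space n, x ≠ 0 → 0 < gauge (K : Set (Space n)) x := fun x hx =>
    (gauge_pos (absorbent_nhds_zero hK) (NormedSpace.isVonNBounded_of_isBounded ℝ K.isBounded)).2 hx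
  have hGi : Integrable G (volume.prod volume) := by
    refine (integrable_prod_iff hGm.aestronglyMeasurable).2 ⟨?_, ?_⟩
    · filter_upwards [Measure.ae_ne volume (0 : Space n)] with x hx
      exact Integrable.mul_const (integral_radial hn (hgpos x hx)).1.ofReal (ψ x)
    · refine (hψi.const_mul (2 * Real.pi / (2 * n - 2))).congr ?_
      filter_upwards [Measure.ae_ne volume (0 : Space n)] with x hx
      simp only [hnG]
      rw [integral_mul_const, (integral_radial hn (hgpos x hx)).2, mul_assoc]
  set F : Space n × ℂ → ℂ := fun p =>
    (K : Set (Space n)).indicator (fun x => ψ (cmul p.2 x)) p.1 with hF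
  have hFG : ∀ w ≠ 0, ∀ x, F (x, w) = ((‖w‖ ^ (2 * n) : ℝ) : ℂ) * G (cmul w x, w) := by
    intro w hw x
    have hw' : 0 < ‖w‖ := norm_pos_iff.2 hw
    have hiff : ‖w‖ ∈ Set.Ici (gauge (K : Set (Space n)) (cmul w x)) ↔
        x ∈ (K : Set (Space n)) := by
      rw [mem_iff_gauge_le_one K hK, Set.mem_Ici, hrot.gauge_cmul]
      exact mul_le_iff_le_one_right hw'
    by_cases hx : x ∈ (K : Set (Space n))
    · simp only [hF, hG, Set.indicator_of_mem hx, Set.indicator_of_mem (hiff.2 hx)]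
      rw [← mul_assoc, ← Complex.ofReal_mul, mul_inv_cancel₀ (by positivity), Complex.ofReal_one,
        one_mul]
    · simp only [hF, hG, Set.indicator_of_notMem hx, Set.indicator_of_notMem (hiff.not.2 hx)]
      simp
  have hFm : Measurable F := by
    have h1 : MeasurableSet {p : Space n × ℂ | p.1 ∈ (K : Set (Space n))} :=
      (K.isClosed.preimage continuous_fst).measurableSet
    have h2 : Measurable fun p : Space n × ℂ => ψ (cmul p.2 p.1) :=
      (hψ.comp (continuous_cmul.comp continuous_swap)).measurable
    exact h2.indicator h1
  have hGi' := (integrable_prod_iff' hGm.aestronglyMeasurable).1 hGi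
  have hFi : Integrable F (volume.prod volume) := by
    refine (integrable_prod_iff' hFm.aestronglyMeasurable).2 ⟨?_, ?_⟩
    · filter_upwards [hGi'.1, Measure.ae_ne volume (0 : ℂ)] with w hw hw0
      simp only [hFG w hw0]
      exact (integrable_comp_cmul hw hw0).const_mul _
    · refine hGi'.2.congr ?_
      filter_upwards [Measure.ae_ne volume (0 : ℂ)] with w hw0
      have hw' : 0 < ‖w‖ := norm_pos_iff.2 hw0
      simp only [hFG w hw0, norm_mul, Complex.norm_real]
      rw [integral_const_mul, integral_comp_cmul (fun x => ‖G (x, w)‖) hw0,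
        Real.norm_of_nonneg (by positivity), smul_eq_mul, mul_inv_cancel_left₀ (by positivity)]
  refine ⟨hFi, ?_⟩
  calc ∫ p, F p = ∫ w, ∫ x, F (x, w) := integral_prod_symm F hFi
    _ = ∫ w, ∫ x, G (x, w) := by
      refine integral_congr_ae ?_
      filter_upwards [Measure.ae_ne volume (0 : ℂ)] with w hw0
      have hw' : 0 < ‖w‖ := norm_pos_iff.2 hw0
      simp only [hFG w hw0]
      rw [integral_const_mul, integral_comp_cmul (fun x => G (x, w)) hw0, Complex.real_smul,
        ← mul_assoc, ← Complex.ofReal_mul, mul_inv_cancel₀ (by positivity), Complex.ofReal_one,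
        one_mul]
    _ = ∫ x, ∫ w, G (x, w) := (integral_integral_swap (f := fun x w => G (x, w)) hGi).symm
    _ = _ := by
      rw [← integral_const_mul]
      refine integral_congr_ae ?_
      filter_upwards [Measure.ae_ne volume (0 : Space n)] with x hx
      simp only [hG]
      rw [integral_mul_const, integral_complex_ofReal, (integral_radial hn (hgpos x hx)).2,
        Complex.ofReal_mul, mul_assoc]

/-! ### The Fourier transform along complex lines -/

/-- The Fourier transform of a Gaussian on a complex line. -/
theorem integral_gaussian_character {s : ℝ} (hs : 0 < s) (x y : Space n) :
    ∫ w : ℂ, Complex.exp (-(Complex.I * (inner ℝ (cmul w x) y : ℝ))) *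
        (Real.exp (-(s ^ 2 / 2) * ‖w‖ ^ 2) : ℝ) =
      ((2 * Real.pi / s ^ 2 * Real.exp (-(‖herm x y‖ ^ 2 / (2 * s ^ 2))) : ℝ) : ℂ) := by
  have h := GaussianFourier.integral_cexp_neg_mul_sq_norm_add (V := ℂ) (b := (s ^ 2 / 2 : ℝ))
    (by rw [Complex.ofReal_re]; positivity) (-Complex.I) ((starRingEnd ℂ) (herm x y))
  rw [Complex.finrank_real_complex] at h
  have hs' : (s : ℂ) ≠ 0 := by exact_mod_cast hs.ne'
  calc _ = _ := integral_congr_ae (Eventually.of_forall fun w => ?_)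
    _ = _ := h
    _ = _ := ?_
  · simp only [inner_cmul_left, Complex.ofReal_exp]
    rw [← Complex.exp_add]
    congr 1
    push_cast
    ring
  · push_cast
    rw [div_self two_ne_zero, Complex.cpow_one, RCLike.norm_conj]
    congr 1
    · field_simp
    · congr 1
      rw [neg_sq, Complex.I_sq]
      field_simp
      ring

theorem norm_exp_neg_I_mul (t : ℝ) : ‖Complex.exp (-(Complex.I * (t : ℂ)))‖ = 1 := by
  rw [mul_comm, ← neg_mul, ← Complex.ofReal_neg, Complex.norm_exp_ofReal_mul_I]

/-- Gaussian averages of the Fourier transform over a complex line. -/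
theorem integral_testFourier_gaussian (φ : 𝓢(Space n, ℂ)) {s : ℝ} (hs : 0 < s) (x : Space n) :
    ∫ w : ℂ, testFourier φ (cmul w x) * (Real.exp (-(s ^ 2 / 2) * ‖w‖ ^ 2) : ℝ) =
      ∫ y, ((2 * Real.pi / s ^ 2 * Real.exp (-(‖herm x y‖ ^ 2 / (2 * s ^ 2))) : ℝ) : ℂ) * φ y := by
  have hb : 0 < s ^ 2 / 2 := by positivity
  have hint : Integrable (Function.uncurry fun (w : ℂ) (y : Space n) =>
      Complex.exp (-(Complex.I * (inner ℝ (cmul w x) y : ℝ))) *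
        (Real.exp (-(s ^ 2 / 2) * ‖w‖ ^ 2) : ℝ) * φ y) (volume.prod volume) := by
    refine ((integrable_gaussian_complex hb).mul_prod (φ.integrable (μ := volume)).norm).mono' ?_ ?_
    · have h1 : Continuous fun p : ℂ × Space n => cmul p.1 x :=
        continuous_cmul.comp (continuous_fst.prodMk continuous_const)
      have h2 := φ.continuous
      refine Continuous.aestronglyMeasurable ?_
      simp only [Function.uncurry_def]
      fun_prop
    · refine Eventually.of_forall fun p => ?_
      simp only [Function.uncurry_def]
      rw [norm_mul, norm_mul, norm_exp_neg_I_mul, one_mul, Complex.norm_real,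
        Real.norm_of_nonneg (Real.exp_pos _).le]
  calc _ = ∫ w : ℂ, ∫ y, Complex.exp (-(Complex.I * (inner ℝ (cmul w x) y : ℝ))) *
        (Real.exp (-(s ^ 2 / 2) * ‖w‖ ^ 2) : ℝ) * φ y := by
        refine integral_congr_ae (Eventually.of_forall fun w => ?_)
        simp only [testFourier_apply]
        rw [← integral_mul_const]
        refine integral_congr_ae (Eventually.of_forall fun y => ?_)
        simp only
        ring
    _ = _ := integral_integral_swap hint
    _ = _ := by
        refine integral_congr_ae (Eventually.of_forall fun y => ?_)
        simp only
        rw [integral_mul_const, integral_gaussian_character hs]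

theorem integral_body_gaussian (K : ConvexBody (Space n)) (φ : 𝓢(Space n, ℂ)) {s : ℝ}
    (hs : 0 < s) :
    ∫ x in (K : Set (Space n)), ∫ y,
        ((2 * Real.pi / s ^ 2 * Real.exp (-(‖herm x y‖ ^ 2 / (2 * s ^ 2))) : ℝ) : ℂ) * φ y =
      ∫ y, (gaussianSection (K : Set (Space n)) s y : ℂ) * φ y := by
  have : IsFiniteMeasure (volume.restrict (K : Set (Space n))) :=
    ⟨by rw [Measure.restrict_apply_univ]; exact K.isCompact.measure_lt_top⟩
  rw [integral_integral_swap]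
  · refine integral_congr_ae (Eventually.of_forall fun y => ?_)
    simp only
    rw [integral_mul_const, integral_complex_ofReal, gaussianSection]
  · refine ((integrable_const (2 * Real.pi / s ^ 2)).mul_prod
      (φ.integrable (μ := volume)).norm).mono' ?_ ?_
    · have h1 := continuous_herm (n := n)
      have h2 := φ.continuous
      refine Continuous.aestronglyMeasurable ?_
      simp only [Function.uncurry_def]
      fun_prop
    · refine Eventually.of_forall fun p => ?_
      simp only [Function.uncurry_def]
      rw [norm_mul, Complex.norm_real, Real.norm_of_nonneg (by positivity)]
      gcongr
      refine mul_le_of_le_one_right (by positivity) (Real.exp_le_one_iff.2 ?_)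
      exact neg_nonpos.2 (by positivity)

theorem measurable_gaussianSection (K : ConvexBody (Space n)) (s : ℝ) :
    Measurable (gaussianSection (K : Set (Space n)) s) := by
  have : IsFiniteMeasure (volume.restrict (K : Set (Space n))) :=
    ⟨by rw [Measure.restrict_apply_univ]; exact K.isCompact.measure_lt_top⟩
  have h1 := continuous_herm (n := n)
  have h : Continuous fun p : Space n × Space n =>
      2 * Real.pi / s ^ 2 * Real.exp (-(‖herm p.1 p.2‖ ^ 2 / (2 * s ^ 2))) := by
    fun_prop
  exact (h.stronglyMeasurable.integral_prod_left'
    (μ := volume.restrict (K : Set (Space n)))).measurable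

/-- Both sides are the limit, as `s → 0`, of the integral of the Fourier transform of `φ` over the
complex lines through the points of `K`, damped by `exp(-s²|w|²/2)`: the left one by integrating
over the lines in polar coordinates, the right one by Fourier inversion on each line. -/
theorem integral_gauge_mul_testFourier (hn : 2 ≤ n) (K : ConvexBody (Space n))
    (hK : (K : Set (Space n)) ∈ 𝓝 0) (hrot : IsRotationInvariant (K : Set (Space n)))
    (φ : 𝓢(Space n, ℂ))
    (hi : Integrable fun x =>
      (gauge (K : Set (Space n)) x ^ (2 * n - 2))⁻¹ * ‖testFourier φ x‖) :
    ((2 * Real.pi / (2 * n - 2) : ℝ) : ℂ) *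
        ∫ x, ((gauge (K : Set (Space n)) x ^ (2 * n - 2))⁻¹ : ℝ) * testFourier φ x =
      ∫ y, ((4 * Real.pi ^ 2 * (‖y‖ ^ 2)⁻¹ *
        sectionVolume (K : Set (Space n)) (complexHyperplane y) : ℝ) : ℂ) * φ y := by
  have hnt : Nontrivial (Space n) :=
    Module.nontrivial_of_finrank_pos (R := ℝ) (by simp; omega)
  obtain ⟨hF, hFeq⟩ := integral_complex_lines hn K hK hrot (testFourier φ).continuous hi
  rw [← hFeq]
  set F : Space n × ℂ → ℂ := fun p =>
    (K : Set (Space n)).indicator (fun x => testFourier φ (cmul p.2 x)) p.1 with hFdef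
  have hgle : ∀ (s : ℝ) (p : Space n × ℂ),
      ‖F p * (Real.exp (-(s ^ 2 / 2) * ‖p.2‖ ^ 2) : ℝ)‖ ≤ ‖F p‖ := fun s p => by
    rw [norm_mul, Complex.norm_real, Real.norm_of_nonneg (Real.exp_pos _).le]
    refine mul_le_of_le_one_right (norm_nonneg _) (Real.exp_le_one_iff.2 ?_)
    rw [neg_mul]
    exact neg_nonpos.2 (by positivity)
  have hgm : ∀ s : ℝ, AEStronglyMeasurable (fun p : Space n × ℂ =>
      F p * (Real.exp (-(s ^ 2 / 2) * ‖p.2‖ ^ 2) : ℝ)) := fun s =>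
    hF.aestronglyMeasurable.mul (Continuous.aestronglyMeasurable (by fun_prop))
  have hleft : Tendsto (fun s : ℝ => ∫ p : Space n × ℂ,
      F p * (Real.exp (-(s ^ 2 / 2) * ‖p.2‖ ^ 2) : ℝ)) (𝓝[>] 0) (𝓝 (∫ p, F p)) := by
    refine tendsto_integral_filter_of_dominated_convergence (fun p => ‖F p‖)
      (Eventually.of_forall hgm)
      (Eventually.of_forall fun s => Eventually.of_forall (hgle s)) hF.norm
      (Eventually.of_forall fun p => ?_)
    have h : Continuous fun s : ℝ => F p * (Real.exp (-(s ^ 2 / 2) * ‖p.2‖ ^ 2) : ℝ) := by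
      fun_prop
    have h0 := h.tendsto 0
    simp only [ne_eq, OfNat.ofNat_ne_zero, not_false_eq_true, zero_pow, zero_div, neg_zero,
      zero_mul, Real.exp_zero, Complex.ofReal_one, mul_one] at h0
    exact h0.mono_left nhdsWithin_le_nhds
  obtain ⟨C, hC⟩ := exists_gaussianSection_le (by omega) K
  have hright : Tendsto (fun s : ℝ => ∫ y, (gaussianSection (K : Set (Space n)) s y : ℂ) * φ y)
      (𝓝[>] 0) (𝓝 (∫ y, ((4 * Real.pi ^ 2 * (‖y‖ ^ 2)⁻¹ *
        sectionVolume (K : Set (Space n)) (complexHyperplane y) : ℝ) : ℂ) * φ y)) := by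
    refine tendsto_integral_filter_of_dominated_convergence
      (fun y => C * ((‖y‖ ^ 2)⁻¹ * ‖φ y‖)) ?_ ?_ ?_ ?_
    · refine Eventually.of_forall fun s => Measurable.aestronglyMeasurable ?_
      exact (Complex.measurable_ofReal.comp (measurable_gaussianSection K s)).mul
        φ.continuous.measurable
    · filter_upwards [self_mem_nhdsWithin] with s hs
      filter_upwards [Measure.ae_ne volume (0 : Space n)] with y hy
      rw [norm_mul, Complex.norm_real, Real.norm_of_nonneg (gaussianSection_nonneg _ _ _),
        ← mul_assoc]
      exact mul_le_mul_of_nonneg_right (hC s hs y hy) (norm_nonneg _)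
    · exact (integrable_inv_norm_pow_mul_schwartz (by simp; omega) φ).const_mul C
    · filter_upwards [Measure.ae_ne volume (0 : Space n)] with y hy
      exact ((Complex.continuous_ofReal.tendsto _).comp
        (tendsto_gaussianSection (by omega) K hK hy)).mul_const _
  refine tendsto_nhds_unique hleft (hright.congr' ?_)
  filter_upwards [self_mem_nhdsWithin] with s hs
  rw [← integral_body_gaussian K φ hs, ← integral_indicator K.isClosed.measurableSet]
  have hgi : Integrable (fun p : Space n × ℂ =>
      F p * (Real.exp (-(s ^ 2 / 2) * ‖p.2‖ ^ 2) : ℝ)) (volume.prod volume) :=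
    hF.norm.mono' (hgm s) (Eventually.of_forall (hgle s))
  refine Eq.trans ?_ (integral_prod _ hgi).symm
  refine integral_congr_ae (Eventually.of_forall fun x => ?_)
  by_cases hx : x ∈ (K : Set (Space n))
  · simp only [hFdef, Set.indicator_of_mem hx]
    exact (integral_testFourier_gaussian φ hs x).symm
  · simp only [hFdef, Set.indicator_of_notMem hx, zero_mul, integral_zero]

/-! ### Tempered distributions given by functions -/

section Distributions

variable {E : Type*} [NormedAddCommGroup E] [InnerProductSpace ℝ E] [FiniteDimensional ℝ E]
  [MeasurableSpace E] [BorelSpace E]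

/-- A nonnegative function of at most polynomial growth in the mean defines a tempered
distribution: its density is a measure of temperate growth. -/
theorem exists_isGivenBy {f : E → ℝ} (hf : Measurable f) (h0 : ∀ x, 0 ≤ f x) {m : ℕ}
    (hi : Integrable fun x => f x * (1 + ‖x‖) ^ (-(m : ℝ))) :
    ∃ T : 𝓢'(E, ℂ), IsGivenBy T fun x => (f x : ℂ) := by
  have hd : Measurable fun x => (f x).toNNReal := hf.real_toNNReal
  let μ : Measure E := volume.withDensity fun x => ((f x).toNNReal : ENNReal)
  have hμ : μ.HasTemperateGrowth := by
    refine ⟨m, (integrable_withDensity_iff_integrable_smul hd).2 (hi.congr ?_)⟩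
    exact Eventually.of_forall fun x => by simp [NNReal.smul_def, h0 x]
  refine ⟨μ.toTemperedDistribution, fun φ => ?_⟩
  have hsmul : ∀ x, (f x).toNNReal • φ x = (f x : ℂ) * φ x := fun x => by
    rw [NNReal.smul_def, Real.coe_toNNReal _ (h0 x), Complex.real_smul]
  have h1 := (integrable_withDensity_iff_integrable_smul hd).1 (φ.integrable (μ := μ))
  have h2 : ∫ x, φ x ∂μ = _ := integral_withDensity_eq_integral_smul hd φ
  simp only [hsmul] at h1 h2
  exact ⟨h1, h2⟩

/-- Two functions that are continuous off the origin and give the same distribution agree there. -/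
theorem IsGivenBy.eqOn_compl_zero {T : 𝓢'(E, ℂ)} {g g' : E → ℂ} (hT : IsGivenBy T g)
    (hT' : IsGivenBy T g') (hg : ContinuousOn g {0}ᶜ) (hg' : ContinuousOn g' {0}ᶜ) :
    Set.EqOn g g' {0}ᶜ := by
  have hU : IsOpen ({0}ᶜ : Set E) := isOpen_compl_singleton
  have hloc : LocallyIntegrableOn (fun x => g x - g' x) {0}ᶜ (volume : Measure E) :=
    (hg.sub hg').locallyIntegrableOn hU.measurableSet
  have h := hU.ae_eq_zero_of_integral_contDiff_smul_eq_zero hloc fun χ hχ hχc _ => by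
    have hχ' : ContDiff ℝ ∞ fun x => (χ x : ℂ) := Complex.ofRealCLM.contDiff.comp hχ
    have hχc' : HasCompactSupport fun x => (χ x : ℂ) := hχc.comp_left Complex.ofReal_zero
    obtain ⟨h1, h2⟩ := hT (hχc'.toSchwartzMap hχ')
    obtain ⟨h1', h2'⟩ := hT' (hχc'.toSchwartzMap hχ')
    have h3 := integral_sub h1 h1'
    rw [← h2, ← h2', sub_self] at h3
    rw [← h3]
    refine integral_congr_ae (Eventually.of_forall fun x => ?_)
    simp only [HasCompactSupport.toSchwartzMap_toFun, Complex.real_smul]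
    change (χ x : ℂ) * (g x - g' x) = g x * (χ x : ℂ) - g' x * (χ x : ℂ)
    ring
  refine Measure.eqOn_open_of_ae_eq (μ := volume) ?_ hU hg hg'
  refine (ae_restrict_iff' hU.measurableSet).2 ?_
  filter_upwards [h] with x hx hx0
  exact sub_eq_zero.1 (hx hx0)

end Distributions

theorem zero_mem_nhds_of_symm {E : Type*} [NormedAddCommGroup E] [NormedSpace ℝ E]
    {K : Set E} (hK : Convex ℝ K) (hint : (interior K).Nonempty)
    (hsymm : ∀ x ∈ K, -x ∈ K) : K ∈ 𝓝 0 := by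
  obtain ⟨x, hx⟩ := hint
  have h := hK.combo_interior_self_mem_interior hx (hsymm x (interior_subset hx))
    (a := 1 / 2) (b := 1 / 2) (by norm_num) (by norm_num) (by norm_num)
  rw [smul_neg, add_neg_cancel] at h
  exact mem_interior_iff_mem_nhds.1 h

theorem sectionVolume_le {K : Set (Space n)} {R : ℝ} (hR : K ⊆ Metric.closedBall 0 R)
    {y : Space n} (hy : y ≠ 0) :
    sectionVolume K (complexHyperplane y) ≤ volume.real (Metric.closedBall (0 : Model n) R) := by
  obtain ⟨e, he, hye⟩ := exists_smul_unit hy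
  obtain ⟨L, hL⟩ := exists_isometry_complexHyperplane e he
  rw [hye, complexHyperplane_smul (norm_ne_zero_iff.2 hy), sectionVolume_eq K he L hL]
  simpa [parallelSection, cmul_apply] using! parallelSection_le hR L hL 0

/-- The function which represents the Fourier transform of the power `2 - 2n` of the Minkowski
functional of `K`: the volumes of the complex sections, extended homogeneously. -/
def sectionFunction (K : Set (Space n)) (y : Space n) : ℝ :=
  4 * Real.pi * (n - 1) * ((‖y‖ ^ 2)⁻¹ * sectionVolume K (complexHyperplane y))

theorem continuousOn_sectionFunction (K : ConvexBody (Space n))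
    (hK : (K : Set (Space n)) ∈ 𝓝 0) :
    ContinuousOn (fun y => (sectionFunction (K : Set (Space n)) y : ℂ)) {0}ᶜ := by
  refine Complex.continuous_ofReal.comp_continuousOn ?_
  refine continuousOn_const.mul (ContinuousOn.mul ?_ (continuousOn_sectionVolume K hK))
  exact (continuousOn_id.norm.pow 2).inv₀ fun y hy => pow_ne_zero _ (norm_ne_zero_iff.2 hy)

theorem gauge_rpow_eq (hn : 2 ≤ n) (K : Set (Space n)) (x : Space n) :
    gauge K x ^ (-2 * (n : ℝ) + 2) = (gauge K x ^ (2 * n - 2))⁻¹ := by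
  have h : -2 * (n : ℝ) + 2 = -((2 * n - 2 : ℕ) : ℝ) := by
    rw [Nat.cast_sub (by omega)]
    push_cast
    ring
  rw [h, Real.rpow_neg (gauge_nonneg x), Real.rpow_natCast]

theorem isGivenBy_distFourier (hn : 2 ≤ n) (K : ConvexBody (Space n))
    (hK : (K : Set (Space n)) ∈ 𝓝 0) (hrot : IsRotationInvariant (K : Set (Space n)))
    {T : 𝓢'(Space n, ℂ)}
    (hT : IsGivenBy T fun x => (((gauge (K : Set (Space n)) x ^ (2 * n - 2))⁻¹ : ℝ) : ℂ)) :
    IsGivenBy (distFourier T) fun y => (sectionFunction (K : Set (Space n)) y : ℂ) := by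
  have hnt : Nontrivial (Space n) :=
    Module.nontrivial_of_finrank_pos (R := ℝ) (by simp; omega)
  obtain ⟨R, hR0, hR⟩ := exists_pos_subset_closedBall K
  have hn' : (2 : ℝ) ≤ n := by exact_mod_cast hn
  intro φ
  constructor
  · have hm : AEStronglyMeasurable (fun y => (sectionFunction (K : Set (Space n)) y : ℂ))
        (volume : Measure (Space n)) := by
      have := (continuousOn_sectionFunction K hK).aestronglyMeasurable (μ := volume)
        isOpen_compl_singleton.measurableSet
      rwa [restrict_compl_singleton] at this
    refine ((integrable_inv_norm_pow_mul_schwartz (k := 2) (by simp; omega) φ).const_mul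
      (4 * Real.pi * (n - 1) * volume.real (Metric.closedBall (0 : Model n) R))).mono'
      (hm.mul φ.continuous.aestronglyMeasurable) ?_
    filter_upwards [Measure.ae_ne volume (0 : Space n)] with y hy
    have h1 : (0 : ℝ) ≤ n - 1 := by linarith
    have h2 : 0 ≤ sectionVolume (K : Set (Space n)) (complexHyperplane y) := ENNReal.toReal_nonneg
    have h3 := sectionVolume_le hR hy
    rw [norm_mul, Complex.norm_real, Real.norm_of_nonneg (by unfold sectionFunction; positivity),
      sectionFunction]
    calc _ = 4 * Real.pi * (n - 1) * sectionVolume (K : Set (Space n)) (complexHyperplane y) *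
          ((‖y‖ ^ 2)⁻¹ * ‖φ y‖) := by ring
      _ ≤ _ := by gcongr
  · obtain ⟨h1, h2⟩ := hT (testFourier φ)
    rw [distFourier_apply, h2]
    have hi : Integrable fun x =>
        (gauge (K : Set (Space n)) x ^ (2 * n - 2))⁻¹ * ‖testFourier φ x‖ := by
      refine h1.norm.congr (Eventually.of_forall fun x => ?_)
      simp only [norm_mul, Complex.norm_real]
      rw [Real.norm_of_nonneg (inv_nonneg.2 (pow_nonneg (gauge_nonneg x) _))]
    -- `4π² / (2π / (2n - 2)) = 4π(n - 1)` is the constant of the theorem.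
    have key := integral_gauge_mul_testFourier hn K hK hrot φ hi
    set c : ℝ := 2 * Real.pi / (2 * n - 2) with hc
    have hn1 : (2 * n - 2 : ℝ) ≠ 0 := by linarith
    have hc0 : c ≠ 0 := div_ne_zero Real.two_pi_pos.ne' hn1
    have hc0' : (c : ℂ) ≠ 0 := by exact_mod_cast hc0
    refine mul_left_cancel₀ hc0' (key.trans ?_)
    rw [← integral_const_mul]
    refine integral_congr_ae (Eventually.of_forall fun y => ?_)
    simp only
    rw [← mul_assoc, ← Complex.ofReal_mul]
    congr 2
    rw [sectionFunction, hc]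
    have hn2 : (n - 1 : ℝ) ≠ 0 := by linarith
    rw [show (2 * n - 2 : ℝ) = 2 * (n - 1) by ring]
    field_simp

theorem exists_isGivenBy_gauge (hn : 2 ≤ n) (K : ConvexBody (Space n))
    (hK : (K : Set (Space n)) ∈ 𝓝 0) :
    ∃ T : 𝓢'(Space n, ℂ),
      IsGivenBy T fun x => (((gauge (K : Set (Space n)) x ^ (2 * n - 2))⁻¹ : ℝ) : ℂ) := by
  obtain ⟨R, hR0, hR⟩ := exists_pos_subset_closedBall K
  have hm : Measurable fun x => (gauge (K : Set (Space n)) x ^ (2 * n - 2))⁻¹ :=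
    ((continuous_gauge K.convex hK).measurable.pow_const _).inv
  have h0 : ∀ x, 0 ≤ (gauge (K : Set (Space n)) x ^ (2 * n - 2))⁻¹ := fun x =>
    inv_nonneg.2 (pow_nonneg (gauge_nonneg x) _)
  refine exists_isGivenBy hm h0 (m := finrank ℝ (Space n) + 1) ?_
  refine ((integrable_inv_norm_pow_mul (E := Space n) (k := 2 * n - 2) (by simp; omega)).const_mul
    (R ^ (2 * n - 2))).mono' (Measurable.aestronglyMeasurable (by fun_prop))
    (Eventually.of_forall fun x => ?_)
  rw [Real.norm_of_nonneg (mul_nonneg (h0 x) (by positivity)), ← mul_assoc]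
  exact mul_le_mul_of_nonneg_right (inv_gauge_pow_le hK hR0 hR (by omega) x) (by positivity)

end ComplexSections
end

/-- The distribution `‖x‖_K^(-2n+2)` is well defined, its Fourier transform is a continuous function
away from the origin, and the values of that function on the unit sphere give the volumes of the
sections of `K` by complex hyperplanes. -/
theorem theorem1 (n : ℕ) (hn : 2 ≤ n) (K : ConvexBody (Space n))
    (hint : (interior (K : Set (Space n))).Nonempty)
    (hsymm : ∀ x ∈ K, -x ∈ K)
    (hsmooth : IsInfinitelySmooth (K : Set (Space n)))
    (hrot : IsRotationInvariant (K : Set (Space n))) :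
    ∃ T : 𝓢'(Space n, ℂ),
      IsGivenBy T (fun x => ((gauge (K : Set (Space n)) x ^ (-2 * (n : ℝ) + 2) : ℝ) : ℂ)) ∧
      (∃ g : Space n → ℂ, ContinuousOn g {0}ᶜ ∧ IsGivenBy (distFourier T) g) ∧
      ∀ g : Space n → ℂ, ContinuousOn g {0}ᶜ → IsGivenBy (distFourier T) g →
        ∀ ξ ∈ Metric.sphere (0 : Space n) 1,
          (sectionVolume (K : Set (Space n)) (complexHyperplane ξ) : ℂ) =
            1 / (4 * (Real.pi : ℂ) * ((n : ℂ) - 1)) * g ξ := by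
  have hK := zero_mem_nhds_of_symm K.convex hint hsymm
  obtain ⟨T, hT⟩ := exists_isGivenBy_gauge hn K hK
  have hF := isGivenBy_distFourier hn K hK hrot hT
  have hc := continuousOn_sectionFunction K hK
  refine ⟨T, by simpa only [gauge_rpow_eq hn] using hT, ⟨_, hc, hF⟩, fun g hg hgT ξ hξ => ?_⟩
  have hξ1 : ‖ξ‖ = 1 := by simpa using hξ
  have hξ0 : ξ ∈ ({0}ᶜ : Set (Space n)) := norm_ne_zero_iff.1 (by rw [hξ1]; exact one_ne_zero)
  rw [hgT.eqOn_compl_zero hF hg hc hξ0]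
  simp only [sectionFunction, hξ1]
  have hn1 : (n : ℂ) - 1 ≠ 0 := sub_ne_zero.2 (by exact_mod_cast (by omega : n ≠ 1))
  have hpi : (Real.pi : ℂ) ≠ 0 := by exact_mod_cast Real.pi_ne_zero
  push_cast
  field_simp
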